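/- Let $\mathfrak p$ be the pseudointersection number, i.e. the least cardinality of a family $F$ of subsets of $\omega$ such that every intersection of finitely many members of $F$ is infinite ($F$ is centered) but there is no infinite $P\subseteq\omega$ with $P\setminus A$ finite for all $A\in F$ (no infinite pseudointersection of $F$). Let $2^{<\mathfrak p}$ be the tree of binary sequences $s$ of ordinal length $l(s)<\mathfrak p$, ordered by end-extension. Call $(a_t)_{t\in 2^{<\mathfrak p}}$, $a_t\subseteq\omega$, a pseudointersection labeling if it arises from the following recursion (with arbitrary choices): $a_\emptyset=\omega$; if $l(s)$ is a limit ordinal, $a_s$ is an infinite pseudointersection of $\{a_r:r<s\}$; and for every $t\in 2^{<\mathfrak p}$ there are an infinite pseudointersection $P$ of $\{a_r:r\le t\}$ and an infinite $P'\subseteq P$ with $P\setminus P'$ infinite such that $a_{t^\frown 0}=P'$ and $a_{t^\frown 1}=\omega\setminus P'$. Let $T=\{s\in 2^{<\mathfrak p}: l(s)\text{ is a successor ordinal}\}$. All Boolean algebras $A\subseteq\mathcal P(\omega)$ below contain all finite sets: the algebra generated by a family is the one generated by this family and the finite sets. For an algebra $A$, an ultrafilter $u$ on $A$ and $x\subseteq\omega$,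 say that $x$ is minimal for $(A,u)$ if $u$ is the unique ultrafilter on $A$ that does not generate an ultrafilter on the algebra generated by $A\cup\{x\}$. A set $S\subseteq 2^{<\kappa}$ is an acceptable tree if all its nodes have successor length, every $r\le s\in S$ of successor length is in $S$, and $t^\frown0\in S\iff t^\frown1\in S$ for all $t\in 2^{<\kappa}$. For an acceptable tree $S$ and a labeling $(a_t)_{t\in S}$, the algebra generated by $\{a_t:t\in S\}$ is an $S$-algebra if each $a_t$ is infinite, $a_{t^\frown1}=\omega\setminus a_{t^\frown0}$ whenever $t^\frown i\in S$, and for every $t\in S$ the family $\{a_s:s\in S,\ s<t\}$ is centered and $a_t$ is minimal for $(A_t,u_t)$, where $A_t$ is the algebra generated by $\{a_s:s\in S,\ s<t\}$ and $u_t$ is the ultrafilter on $A_t$ generated by these sets and the cofinite sets. The Stone space of $A$ is the set of ultrafilters on $A$ with the topology generated by the sets $\{u: b\in u\}$, $b\in A$. Theorem. Pseudointersection labelings exist. For every pseudointersection labeling $(a_t)_{t\in 2^{<\mathfrak p}}$, the set $T$ is an acceptable tree, the algebra generated by $\{a_t:t\in T\}$ is a $T$-algebra, and the Stone space of this $T$-algebra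 is sequentially compact, i.e. every sequence in it has a convergent subsequence. -/

import Mathlib

open Set Cardinal Order

/-- `P` is an (infinite) pseudointersection of the family `F`. -/
def IsPseudointersection (P : Set ℕ) (F : Set (Set ℕ)) : Prop :=
  P.Infinite ∧ ∀ A ∈ F, (P \ A).Finite

/-- `F` is centered: all intersections of finitely many members are infinite. -/
def IsCentered (F : Set (Set ℕ)) : Prop :=
  ∀ G : Set (Set ℕ), G ⊆ F → G.Finite → (⋂₀ G).Infinite

/-- The pseudointersection number: the least size of a centered family of subsets of `ℕ` with no
infinite pseudointersection. -/
noncomputable def pseudointersectionNumber : Cardinal.{0} :=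
  sInf {κ | ∃ F : Set (Set ℕ), IsCentered F ∧ (¬ ∃ P, IsPseudointersection P F) ∧ κ = #F}

/-- A transfinite binary sequence of length `length`; its terms are `val α` for `α < length`
(`false` is `0`, `true` is `1`). The values beyond the length are fixed to be `false`, so that two
sequences are equal iff they have the same length and the same terms. -/
@[ext]
structure BinSeq where
  length : Ordinal.{0}
  val : Ordinal.{0} → Bool
  val_of_length_le : ∀ α, length ≤ α → val α = false

namespace BinSeq

/-- The order by extension (initial segments). -/
instance : PartialOrder BinSeq where
  le s t := s.length ≤ t.length ∧ ∀ α < s.length, s.val α = t.val α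
  le_refl s := ⟨le_rfl, fun _ _ => rfl⟩
  le_trans s t u hst htu := ⟨hst.1.trans htu.1,
    fun α hα => (hst.2 α hα).trans (htu.2 α (hα.trans_le hst.1))⟩
  le_antisymm s t hst hts := by
    have hl : s.length = t.length := le_antisymm hst.1 hts.1
    refine BinSeq.ext hl (funext fun α => ?_)
    rcases lt_or_ge α s.length with h | h
    · exact hst.2 α h
    · rw [s.val_of_length_le α h, t.val_of_length_le α (hl ▸ h)]

/-- The empty sequence. -/
noncomputable def empty : BinSeq := ⟨0, fun _ => false, fun _ _ => rfl⟩

open Classical in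
/-- The sequence `t` extended by one further term `i`. -/
noncomputable def snoc (t : BinSeq) (i : Bool) : BinSeq where
  length := t.length + 1
  val α := if α = t.length then i else t.val α
  val_of_length_le α h := by
    have hlt : t.length < α := lt_of_lt_of_le (lt_add_one _) h
    rw [if_neg hlt.ne', t.val_of_length_le α hlt.le]

/-- The full binary tree of height `κ`: all binary sequences of length less than `κ`. -/
def fullTree (κ : Cardinal.{0}) : Set BinSeq := {s | s.length < κ.ord}

/-- The nodes of successor length in the full binary tree of height `κ`. -/
def succTree (κ : Cardinal.{0}) : Set BinSeq :=
  {s | s ∈ fullTree κ ∧ ∃ α, s.length = α + 1}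

/-- Acceptable subtrees of the full binary tree of height `κ`. -/
structure IsAcceptable (κ : Cardinal.{0}) (T : Set BinSeq) : Prop where
  subset : T ⊆ fullTree κ
  length_succ : ∀ t ∈ T, ∃ α, t.length = α + 1
  mem_of_le : ∀ s ∈ T, ∀ r ≤ s, (∃ α, r.length = α + 1) → r ∈ T
  snoc_iff : ∀ t ∈ fullTree κ, t.snoc false ∈ T ↔ t.snoc true ∈ T

end BinSeq

/-- The Boolean algebra of subsets of `ℕ` generated by the family `F` together with all finite
sets. -/
def generatedAlgebra (F : Set (Set ℕ)) : BooleanSubalgebra (Set ℕ) :=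
  BooleanSubalgebra.closure (F ∪ {x | x.Finite})

/-- The Boolean algebra generated by `A` and `x`. -/
def adjoin (A : BooleanSubalgebra (Set ℕ)) (x : Set ℕ) : BooleanSubalgebra (Set ℕ) :=
  BooleanSubalgebra.closure ((A : Set (Set ℕ)) ∪ {x})

/-- `u` is an ultrafilter on the Boolean algebra `A` of subsets of `ℕ`. -/
structure IsUltrafilterOn (A : BooleanSubalgebra (Set ℕ)) (u : Set (Set ℕ)) : Prop where
  mem_algebra : ∀ x ∈ u, x ∈ A
  univ_mem : Set.univ ∈ u
  empty_notMem : ∅ ∉ u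
  inter_mem : ∀ x ∈ u, ∀ y ∈ u, x ∩ y ∈ u
  mem_of_superset : ∀ x ∈ u, ∀ y ∈ A, x ⊆ y → y ∈ u
  mem_or_compl_mem : ∀ x ∈ A, x ∈ u ∨ xᶜ ∈ u

/-- The filter on the Boolean algebra `A` generated by the family `G`. -/
def generatedFilter (A : BooleanSubalgebra (Set ℕ)) (G : Set (Set ℕ)) : Set (Set ℕ) :=
  {x | x ∈ A ∧ ∃ H : Set (Set ℕ), H ⊆ G ∧ H.Finite ∧ ⋂₀ H ⊆ x}

/-- `x` is minimal for `(A, u)`: `u` is the unique ultrafilter on `A` that does not generate an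
ultrafilter on the algebra generated by `A` and `x`. -/
def IsMinimalFor (x : Set ℕ) (A : BooleanSubalgebra (Set ℕ)) (u : Set (Set ℕ)) : Prop :=
  ∀ v : Set (Set ℕ),
    (IsUltrafilterOn A v ∧ ¬ IsUltrafilterOn (adjoin A x) (generatedFilter (adjoin A x) v)) ↔ v = u

/-- The sets `a t`, `t ∈ T`, (together with the finite sets) generate a `T`-algebra, where `T` is
an acceptable subtree of the full binary tree of height `κ`. As all algebras contain the finite
sets, the filter attached to a node `t` is generated by the labels below `t` and the cofinite
sets. -/
structure GeneratesTAlgebra (κ : Cardinal.{0}) (T : Set BinSeq) (a : BinSeq → Set ℕ) : Prop where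
  acceptable : BinSeq.IsAcceptable κ T
  infinite : ∀ t ∈ T, (a t).Infinite
  compl : ∀ t : BinSeq, t.snoc false ∈ T → a (t.snoc true) = (a (t.snoc false))ᶜ
  centered : ∀ t ∈ T, IsCentered (a '' {s | s ∈ T ∧ s < t})
  minimal : ∀ t ∈ T, IsMinimalFor (a t) (generatedAlgebra (a '' {s | s ∈ T ∧ s < t}))
    (generatedFilter (generatedAlgebra (a '' {s | s ∈ T ∧ s < t}))
      (a '' {s | s ∈ T ∧ s < t} ∪ {x | xᶜ.Finite}))

/-- The labelings of the full binary tree of height `𝔭` produced by the recursive construction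
with pseudointersections: the root is labeled by `ℕ`; a node `s` of limit length is labeled by a
pseudointersection of the labels below it; and for the two immediate successors of a node `t` one
takes a pseudointersection `P` of the labels strictly below them (that is, of the labels of all
`r ≤ t`) and an infinite `P' ⊆ P` with `P \ P'` infinite, and uses the labels `P'` and `ℕ \ P'`.
Only the labels of sequences of length less than `𝔭` matter. -/
structure IsPseudointersectionLabeling (a : BinSeq → Set ℕ) : Prop where
  root : a BinSeq.empty = Set.univ
  limit : ∀ s ∈ BinSeq.fullTree pseudointersectionNumber, Order.IsSuccLimit s.length →
    IsPseudointersection (a s) (a '' {r | r < s})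
  succ : ∀ t ∈ BinSeq.fullTree pseudointersectionNumber,
    ∃ P P' : Set ℕ, IsPseudointersection P (a '' {r | r ≤ t}) ∧
      P' ⊆ P ∧ P'.Infinite ∧ (P \ P').Infinite ∧
      a (t.snoc false) = P' ∧ a (t.snoc true) = P'ᶜ

/-- The Stone space of a Boolean algebra `A` of subsets of `ℕ`: the set of all ultrafilters
on `A`. -/
def StoneSpace (A : BooleanSubalgebra (Set ℕ)) : Type :=
  {u : Set (Set ℕ) // IsUltrafilterOn A u}

/-- The topology generated by the sets `{u | b ∈ u}`, `b ∈ A`. -/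
instance (A : BooleanSubalgebra (Set ℕ)) : TopologicalSpace (StoneSpace A) :=
  TopologicalSpace.generateFrom {U | ∃ b ∈ A, U = {u : StoneSpace A | b ∈ u.1}}

/-! Existence needs only that the labels of all `r ≤ t` always have a pseudointersection. At a
successor, `P'` or `P \ P'` serves. At a limit, finitely many labels already occur below one earlier
node, so the family is centered, and it has fewer than `𝔭` members.

Minimality: `P` is almost contained in every member of `u_t` but is split by `P'`, so `u_t` cannot
decide the new label. Any other ultrafilter contains the complement of a generator of `u_t`; that
complement meets `P'` in a finite set, so the label is decided.

Sequential compactness: extend the given ultrafilters to ultrafilters `U n` on `ℕ`. If some `{k}`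
lies in infinitely many `U n`, these form a constant subsequence. Otherwise `x ↦ {n | x ∈ U n}`
preserves almost inclusion and complements, and it remains to find an infinite set of indices that
no index set `c t` at a successor node splits (`exists_infinite_forall_not_split`). If there were
none, cut repeatedly by the left label at a minimal splitting node. These nodes increase to some `s`
of limit length. A diagonal set `Z`, almost contained in all successor labels below `s` but disjoint
from `c s`, is then unsplit: above `s` the left labels are almost contained in `c s`, and elsewhere
the path to `s` decides. -/

namespace BinSeq

/-! ### Initial segments, splitting nodes and suprema of binary sequences -/

theorem length_mono {r s : BinSeq} (h : r ≤ s) : r.length ≤ s.length := h.1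

theorem eq_of_le_of_length_le {r s : BinSeq} (h : r ≤ s) (hl : s.length ≤ r.length) : r = s :=
  le_antisymm h ⟨hl, fun α hα => (h.2 α (hα.trans_le hl)).symm⟩

theorem length_lt_length {r s : BinSeq} (h : r < s) : r.length < s.length :=
  lt_of_not_ge fun hl => h.ne (eq_of_le_of_length_le h.le hl)

instance : WellFoundedLT BinSeq :=
  ⟨Subrelation.wf (fun h => length_lt_length h) (InvImage.wf BinSeq.length wellFounded_lt)⟩

theorem snoc_length (t : BinSeq) (i : Bool) : (t.snoc i).length = t.length + 1 := rfl

theorem snoc_val_length (t : BinSeq) (i : Bool) : (t.snoc i).val t.length = i := by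
  simp [snoc]

theorem snoc_val_of_lt (t : BinSeq) (i : Bool) {α : Ordinal} (h : α < t.length) :
    (t.snoc i).val α = t.val α := by
  simp [snoc, h.ne]

theorem lt_snoc_self (t : BinSeq) (i : Bool) : t < t.snoc i := by
  refine lt_of_le_of_ne ⟨(lt_add_one _).le, fun α hα => (snoc_val_of_lt t i hα).symm⟩ fun h => ?_
  have := congrArg BinSeq.length h
  exact (lt_add_one t.length).ne this

/-- Two initial segments of the same sequence are comparable. -/
theorem le_of_le_of_le_of_length_le {r s t : BinSeq} (hr : r ≤ t) (hs : s ≤ t)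
    (h : r.length ≤ s.length) : r ≤ s :=
  ⟨h, fun α hα => (hr.2 α hα).trans (hs.2 α (hα.trans_le h)).symm⟩

theorem lt_snoc_iff {r t : BinSeq} {i : Bool} : r < t.snoc i ↔ r ≤ t := by
  refine ⟨fun h => le_of_le_of_le_of_length_le h.le (lt_snoc_self t i).le ?_,
    fun h => h.trans_lt (lt_snoc_self t i)⟩
  have := length_lt_length h
  rwa [snoc_length, Order.lt_add_one_iff] at this

/-- The initial segment of `t` of length `min α t.length`. -/
noncomputable def take (t : BinSeq) (α : Ordinal.{0}) : BinSeq where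
  length := min α t.length
  val β := if β < α then t.val β else false
  val_of_length_le β h := by
    rcases min_le_iff.1 h with h | h
    · rw [if_neg h.not_gt]
    · rw [t.val_of_length_le β h, ite_self]

theorem take_length {t : BinSeq} {α : Ordinal} (h : α ≤ t.length) : (t.take α).length = α :=
  min_eq_left h

theorem take_val {t : BinSeq} {α β : Ordinal} (h : β < α) : (t.take α).val β = t.val β :=
  if_pos h

theorem take_le (t : BinSeq) (α : Ordinal) : t.take α ≤ t :=
  ⟨min_le_right _ _, fun _ hβ => take_val (hβ.trans_le (min_le_left _ _))⟩

theorem eq_take_of_le {r t : BinSeq} (h : r ≤ t) : r = t.take r.length :=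
  eq_of_le_of_length_le (le_of_le_of_le_of_length_le h (take_le _ _) (take_length h.1).ge)
    (take_length h.1).le

theorem snoc_take_le {t : BinSeq} {α : Ordinal} (h : α < t.length) :
    (t.take α).snoc (t.val α) ≤ t := by
  have hl := take_length h.le
  refine ⟨by rw [snoc_length, hl]; exact Order.add_one_le_of_lt h, fun β hβ => ?_⟩
  rw [snoc_length, hl, Order.lt_add_one_iff] at hβ
  rcases hβ.lt_or_eq with hβ | rfl
  · rw [snoc_val_of_lt _ _ (hl.symm ▸ hβ), take_val hβ]
  · have := snoc_val_length (t.take β) (t.val β)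
    rwa [hl] at this

theorem eq_snoc_of_length {t : BinSeq} {α : Ordinal} (h : t.length = α + 1) :
    t = (t.take α).snoc (t.val α) := by
  have hα : α < t.length := h ▸ lt_add_one α
  refine (eq_of_le_of_length_le (snoc_take_le hα) ?_).symm
  rw [snoc_length, take_length hα.le, h]

theorem exists_snoc_le_of_lt {r s : BinSeq} (h : r < s) : ∃ i, r.snoc i ≤ s := by
  have := snoc_take_le (length_lt_length h)
  rw [← eq_take_of_le h.le] at this
  exact ⟨_, this⟩

/-- Incomparable sequences split at some node. -/
theorem exists_snoc_le_snoc_le {s q : BinSeq} (h : ¬ s ≤ q) (h' : ¬ q ≤ s) :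
    ∃ (m : BinSeq) (i : Bool), m.snoc i ≤ s ∧ m.snoc (!i) ≤ q := by
  have key : ∃ α, α < s.length ∧ α < q.length ∧ s.val α ≠ q.val α := by
    by_contra! hc
    rcases le_total s.length q.length with hl | hl
    · exact h ⟨hl, fun α hα => hc α hα (hα.trans_le hl)⟩
    · exact h' ⟨hl, fun α hα => (hc α (hα.trans_le hl) hα).symm⟩
  obtain ⟨α, ⟨hs, hq, hne⟩, hmin⟩ :=
    wellFounded_lt.has_min {α | α < s.length ∧ α < q.length ∧ s.val α ≠ q.val α} key
  have heq : s.take α = q.take α := by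
    refine eq_of_le_of_length_le ⟨by rw [take_length hs.le, take_length hq.le], fun β hβ => ?_⟩
      (by rw [take_length hs.le, take_length hq.le])
    rw [take_length hs.le] at hβ
    rw [take_val hβ, take_val hβ]
    by_contra hc
    exact hmin β ⟨hβ.trans hs, hβ.trans hq, hc⟩ hβ
  refine ⟨s.take α, s.val α, snoc_take_le hs, ?_⟩
  have : q.val α = !s.val α := by
    revert hne; cases s.val α <;> cases q.val α <;> simp
  rw [heq, ← this]
  exact snoc_take_le hq

/-- A strictly increasing sequence of nodes has a supremum of limit length. -/
theorem exists_sup (t : ℕ → BinSeq) (ht : StrictMono t) :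
    ∃ s : BinSeq, Order.IsSuccLimit s.length ∧ (∀ n, t n < s) ∧ ∀ r < s, ∃ n, r ≤ t n := by
  classical
  have hlt : ∀ {α : Ordinal}, α < (⨆ n, (t n).length) ↔ ∃ n, α < (t n).length :=
    Ordinal.lt_iSup_iff
  let s : BinSeq :=
    { length := ⨆ n, (t n).length
      -- The choice of `n` is immaterial: all `t n` that are long enough agree at `α`.
      val := fun α => if h : ∃ n, α < (t n).length then (t h.choose).val α else false
      val_of_length_le := fun α h => dif_neg fun hc => h.not_gt (hlt.2 hc) }
  have hval : ∀ n α, α < (t n).length → (t n).val α = s.val α := by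
    intro n α hα
    have h : ∃ n, α < (t n).length := ⟨n, hα⟩
    have h1 : s.val α = (t h.choose).val α := dif_pos h
    rw [h1]
    rcases le_total n h.choose with hl | hl
    · exact (ht.monotone hl).2 α hα
    · exact ((ht.monotone hl).2 α h.choose_spec).symm
  have hlen : ∀ n, (t n).length < s.length := fun n =>
    hlt.2 ⟨n + 1, length_lt_length (ht (Nat.lt_succ_self n))⟩
  have hle : ∀ n, t n ≤ s := fun n => ⟨(hlen n).le, hval n⟩
  refine ⟨s, ?_, fun n => lt_of_le_of_ne (hle n) fun h => (hlen n).ne (h ▸ rfl), fun r hr => ?_⟩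
  · rw [Ordinal.isSuccLimit_iff, Order.isSuccPrelimit_iff_succ_lt]
    refine ⟨(zero_le.trans_lt (hlen 0)).ne', fun α hα => ?_⟩
    obtain ⟨n, hn⟩ := hlt.1 hα
    exact (Order.succ_le_of_lt hn).trans_lt (hlen n)
  · obtain ⟨n, hn⟩ := hlt.1 (length_lt_length hr)
    exact ⟨n, le_of_le_of_le_of_length_le hr.le (hle n) hn.le⟩

theorem mem_fullTree_of_le {κ : Cardinal.{0}} {r s : BinSeq} (h : r ≤ s) (hs : s ∈ fullTree κ) :
    r ∈ fullTree κ :=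
  lt_of_le_of_lt h.1 hs

theorem exists_eq_snoc_of_mem_succTree {κ : Cardinal.{0}} {t : BinSeq} (ht : t ∈ succTree κ) :
    ∃ r ∈ fullTree κ, ∃ i, t = r.snoc i := by
  obtain ⟨hf, α, hα⟩ := ht
  have h := eq_snoc_of_length hα
  exact ⟨t.take α, mem_fullTree_of_le (take_le _ _) hf, _, h⟩

theorem isAcceptable_succTree (κ : Cardinal.{0}) : IsAcceptable κ (succTree κ) where
  subset _ h := h.1
  length_succ _ h := h.2
  mem_of_le _ hs _ hr hl := ⟨mem_fullTree_of_le hr hs.1, hl⟩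
  snoc_iff _ _ := Iff.rfl

/-- The set of proper initial segments of a sequence has the size of its length. -/
theorem mk_image_Iio_le (s : BinSeq) (a : BinSeq → Set ℕ) :
    #(a '' {r | r < s} : Set (Set ℕ)) ≤ s.length.card := by
  have h : a '' {r | r < s} ⊆ (fun α => a (s.take α)) '' Set.Iio s.length := by
    rintro _ ⟨r, hr, rfl⟩
    exact ⟨r.length, length_lt_length hr, congrArg a (eq_take_of_le hr.le).symm⟩
  refine (Cardinal.mk_le_mk_of_subset h).trans ?_
  have := Cardinal.mk_image_le_lift (f := fun α => a (s.take α)) (s := Set.Iio s.length)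
  rw [Cardinal.mk_Iio_ordinal] at this
  rw [← Cardinal.lift_le.{1}]
  simpa using this

end BinSeq

/-! ### Pseudointersections and the existence of a labeling -/

theorem IsPseudointersection.mono {P : Set ℕ} {F G : Set (Set ℕ)} (h : IsPseudointersection P F)
    (hG : G ⊆ F) : IsPseudointersection P G :=
  ⟨h.1, fun A hA => h.2 A (hG hA)⟩

theorem IsPseudointersection.subset {P Q : Set ℕ} {F : Set (Set ℕ)}
    (h : IsPseudointersection P F) (hQ : Q.Infinite) (hQP : Q ⊆ P) : IsPseudointersection Q F :=
  ⟨hQ, fun A hA => (h.2 A hA).subset (sdiff_subset_sdiff_left hQP)⟩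

theorem IsPseudointersection.insert {P A : Set ℕ} {F : Set (Set ℕ)}
    (h : IsPseudointersection P F) (hA : P ⊆ A) : IsPseudointersection P (insert A F) := by
  refine ⟨h.1, fun B hB => ?_⟩
  rcases hB with rfl | hB
  · simp [sdiff_eq_empty.2 hA]
  · exact h.2 B hB

theorem IsPseudointersection.isCentered {P : Set ℕ} {F : Set (Set ℕ)}
    (h : IsPseudointersection P F) : IsCentered F := by
  intro G hG hfin
  have h1 : (P \ ⋂₀ G).Finite := by
    refine (hfin.biUnion fun A hA => h.2 A (hG hA)).subset fun x hx => ?_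
    obtain ⟨hxP, hx⟩ := hx
    simp only [mem_sInter, not_forall] at hx
    obtain ⟨A, hA, hxA⟩ := hx
    exact mem_biUnion hA ⟨hxP, hxA⟩
  intro hc
  exact h.1 ((h1.union hc).subset fun x hx => by
    by_cases hxG : x ∈ ⋂₀ G
    · exact Or.inr hxG
    · exact Or.inl ⟨hx, hxG⟩)

theorem exists_isPseudointersection_of_mk_lt {F : Set (Set ℕ)} (hF : IsCentered F)
    (h : #F < pseudointersectionNumber) : ∃ P, IsPseudointersection P F := by
  by_contra hc
  exact notMem_of_lt_csInf' h ⟨F, hF, hc, rfl⟩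

theorem Set.Infinite.exists_infinite_diff_infinite {P : Set ℕ} (hP : P.Infinite) :
    ∃ Q ⊆ P, Q.Infinite ∧ (P \ Q).Infinite := by
  obtain ⟨t, u, rfl, hd, hc⟩ := hP.exists_union_disjoint_cardinal_eq_of_infinite
  have h : t.Infinite ↔ u.Infinite := by
    rw [← Set.infinite_coe_iff, ← Set.infinite_coe_iff, Cardinal.infinite_iff,
      Cardinal.infinite_iff, hc]
  have ht : t.Infinite := by
    rcases Set.infinite_union.1 hP with h1 | h1
    · exact h1
    · exact h.2 h1
  refine ⟨t, subset_union_left, ht, ?_⟩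
  rw [union_sdiff_left, hd.symm.sdiff_eq_left]
  exact h.1 ht

namespace BinSeq

open Classical in
/-- A pseudointersection of the family `F` (if there is one). -/
noncomputable def pick (F : Set (Set ℕ)) : Set ℕ :=
  if h : ∃ P, IsPseudointersection P F then h.choose else ∅

open Classical in
/-- An infinite subset of `P` with infinite complement in `P` (if `P` is infinite). -/
noncomputable def half (P : Set ℕ) : Set ℕ :=
  if h : P.Infinite then h.exists_infinite_diff_infinite.choose else ∅

open Classical in
/-- The label of `s` as a function of the family of labels below `s`. -/
noncomputable def labelStep (s : BinSeq) (F : Set (Set ℕ)) : Set ℕ :=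
  if s.length = 0 then Set.univ
  else if Order.IsSuccLimit s.length then pick F
  else if s.val (Ordinal.pred s.length) then (half (pick F))ᶜ else half (pick F)

/-- A labeling by pseudointersections, defined by recursion on initial segments. -/
noncomputable def labeling : BinSeq → Set ℕ :=
  WellFounded.fix (wellFounded_lt (α := BinSeq)) fun s a =>
    labelStep s {x | ∃ (r : BinSeq) (h : r < s), a r h = x}

theorem labeling_eq (s : BinSeq) : labeling s = labelStep s (labeling '' {r | r < s}) := by
  rw [labeling, WellFounded.fix_eq]
  congr 1
  ext x
  simp

theorem isPseudointersection_pick {F : Set (Set ℕ)} (h : ∃ P, IsPseudointersection P F) :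
    IsPseudointersection (pick F) F := by
  rw [pick, dif_pos h]
  exact h.choose_spec

theorem half_spec {P : Set ℕ} (h : P.Infinite) :
    half P ⊆ P ∧ (half P).Infinite ∧ (P \ half P).Infinite := by
  rw [half, dif_pos h]
  exact h.exists_infinite_diff_infinite.choose_spec

theorem labeling_of_length_eq_zero {s : BinSeq} (h : s.length = 0) : labeling s = Set.univ := by
  rw [labeling_eq, labelStep, if_pos h]

theorem labeling_of_isSuccLimit {s : BinSeq} (h : Order.IsSuccLimit s.length) :
    labeling s = pick (labeling '' {r | r < s}) := by
  rw [labeling_eq, labelStep, if_neg h.ne_zero, if_pos h]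

theorem Iio_snoc (t : BinSeq) (i : Bool) : {r | r < t.snoc i} = {r | r ≤ t} := by
  ext r
  exact lt_snoc_iff

theorem labeling_snoc (t : BinSeq) (i : Bool) :
    labeling (t.snoc i) = if i then (half (pick (labeling '' {r | r ≤ t})))ᶜ
      else half (pick (labeling '' {r | r ≤ t})) := by
  have h0 : (t.snoc i).length ≠ 0 := (zero_le.trans_lt (lt_add_one t.length)).ne'
  have h1 : ¬ Order.IsSuccLimit (t.snoc i).length := fun h =>
    (Order.isSuccPrelimit_iff_succ_lt.1 h.2 _ (lt_add_one t.length)).ne rfl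
  have h2 : (t.snoc i).val (Ordinal.pred (t.snoc i).length) = i := by
    rw [snoc_length, Ordinal.pred_add_one, snoc_val_length]
  rw [labeling_eq, labelStep, if_neg h0, if_neg h1, h2, Iio_snoc]

theorem insert_image_Iio (a : BinSeq → Set ℕ) (s : BinSeq) :
    a '' {r | r ≤ s} = insert (a s) (a '' {r | r < s}) := by
  rw [← image_insert_eq]
  congr 1
  ext r
  simp [le_iff_eq_or_lt]

/-- The nodes below `s` form a chain, so finitely many labels below `s` all occur at or below a
single `t < s`. -/
theorem isCentered_image_Iio (a : BinSeq → Set ℕ) {s : BinSeq} (hs : Order.IsSuccLimit s.length)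
    (h : ∀ t < s, ∃ P, IsPseudointersection P (a '' {r | r ≤ t})) :
    IsCentered (a '' {r | r < s}) := by
  intro G hG hfin
  have key : ∃ t < s, G ⊆ a '' {r | r ≤ t} := by
    induction G, hfin using Set.Finite.induction_on with
    | empty =>
      refine ⟨s.take 0, lt_of_le_of_ne (take_le _ _) fun hc => ?_, empty_subset _⟩
      have := congrArg BinSeq.length hc
      rw [take_length zero_le] at this
      exact hs.ne_bot this.symm
    | @insert x G _ _ ih =>
      obtain ⟨t, ht, hGt⟩ := ih ((subset_insert _ _).trans hG)
      obtain ⟨r, hr, rfl⟩ := hG (mem_insert _ _)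
      rcases le_total r.length t.length with hl | hl
      · have hrt := le_of_le_of_le_of_length_le (le_of_lt hr) ht.le hl
        exact ⟨t, ht, insert_subset ⟨r, hrt, rfl⟩ hGt⟩
      · have htr := le_of_le_of_le_of_length_le ht.le (le_of_lt hr) hl
        exact ⟨r, hr, insert_subset ⟨r, le_refl r, rfl⟩
          (hGt.trans (image_mono fun q (hq : q ≤ t) => hq.trans htr))⟩
  obtain ⟨t, ht, hGt⟩ := key
  obtain ⟨P, hP⟩ := h t ht
  exact hP.isCentered G hGt hfin

/-- This keeps the recursion from ever reaching the default value of `pick`. The bound on the length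
is used at limits, where it makes the family of earlier labels smaller than `𝔭`. -/
theorem exists_isPseudointersection_labeling (s : BinSeq)
    (hs : s ∈ fullTree pseudointersectionNumber) :
    ∃ P, IsPseudointersection P (labeling '' {r | r ≤ s}) := by
  induction s using WellFoundedLT.induction with
  | ind s ih =>
  rcases Ordinal.zero_or_succ_or_isSuccLimit s.length with h0 | ⟨α, hα⟩ | hl
  · refine ⟨Set.univ, infinite_univ, ?_⟩
    rintro _ ⟨r, hr, rfl⟩
    have : r.length = 0 := le_antisymm (h0 ▸ length_mono hr) zero_le
    rw [labeling_of_length_eq_zero this]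
    simp
  · have hst := eq_snoc_of_length (t := s) (α := α) hα.symm
    generalize s.take α = t at hst
    generalize s.val α = i at hst
    subst hst
    have ht := lt_snoc_self t i
    have hP := isPseudointersection_pick (ih t ht (mem_fullTree_of_le ht.le hs))
    obtain ⟨h1, h2, h3⟩ := half_spec hP.1
    rw [insert_image_Iio, Iio_snoc, labeling_snoc]
    -- The left label is the chosen half of the picked set; the right label contains the other half.
    cases i
    · exact ⟨_, (hP.subset h2 h1).insert (by simp)⟩
    · exact ⟨_, (hP.subset h3 sdiff_subset).insert (by simp)⟩
  · have hP : IsPseudointersection (labeling s) (labeling '' {r | r < s}) := by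
      rw [labeling_of_isSuccLimit hl]
      refine isPseudointersection_pick (exists_isPseudointersection_of_mk_lt
        (isCentered_image_Iio _ hl fun t ht => ih t ht (mem_fullTree_of_le ht.le hs)) ?_)
      exact (mk_image_Iio_le s _).trans_lt (Cardinal.lt_ord.1 hs)
    rw [insert_image_Iio]
    exact ⟨_, hP.insert Subset.rfl⟩

end BinSeq

theorem isPseudointersectionLabeling_labeling : IsPseudointersectionLabeling BinSeq.labeling where
  root := BinSeq.labeling_of_length_eq_zero rfl
  limit s hs hl := by
    rw [BinSeq.labeling_of_isSuccLimit hl]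
    refine BinSeq.isPseudointersection_pick ?_
    obtain ⟨P, hP⟩ := BinSeq.exists_isPseudointersection_labeling s hs
    exact ⟨P, hP.mono (image_mono fun r (hr : r < s) => hr.le)⟩
  succ t ht := by
    have hP := BinSeq.isPseudointersection_pick (BinSeq.exists_isPseudointersection_labeling t ht)
    obtain ⟨h1, h2, h3⟩ := BinSeq.half_spec hP.1
    exact ⟨_, _, hP, h1, h2, h3, by rw [BinSeq.labeling_snoc]; simp,
      by rw [BinSeq.labeling_snoc]; simp⟩

/-! ### Ultrafilters on subalgebras and minimality -/

/-- A filter that decides the generators of a Boolean algebra decides all of its members. -/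
theorem mem_or_compl_mem_of_mem_closure {l : Filter ℕ} {S : Set (Set ℕ)}
    (h : ∀ x ∈ S, x ∈ l ∨ xᶜ ∈ l) {x : Set ℕ} (hx : x ∈ BooleanSubalgebra.closure S) :
    x ∈ l ∨ xᶜ ∈ l := by
  induction hx using BooleanSubalgebra.closure_bot_sup_induction with
  | mem x hx => exact h x hx
  | bot => exact Or.inr (by simp)
  | sup x _ y _ hx hy =>
    rcases hx with hx | hx
    · exact Or.inl (Filter.mem_of_superset hx subset_union_left)
    rcases hy with hy | hy
    · exact Or.inl (Filter.mem_of_superset hy subset_union_right)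
    · refine Or.inr ?_
      change (x ∪ y)ᶜ ∈ l
      rw [compl_union]
      exact Filter.inter_mem hx hy
  | compl x _ hx => rwa [compl_compl, or_comm]

theorem mem_generatedFilter {A : BooleanSubalgebra (Set ℕ)} {G : Set (Set ℕ)} {x : Set ℕ} :
    x ∈ generatedFilter A G ↔ x ∈ A ∧ x ∈ Filter.generate G := by
  rw [Filter.mem_generate_iff]
  rfl

theorem isUltrafilterOn_generatedFilter {A : BooleanSubalgebra (Set ℕ)} {G : Set (Set ℕ)}
    (hG : (Filter.generate G).NeBot)
    (h : ∀ x ∈ A, x ∈ Filter.generate G ∨ xᶜ ∈ Filter.generate G) :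
    IsUltrafilterOn A (generatedFilter A G) where
  mem_algebra x hx := hx.1
  univ_mem := mem_generatedFilter.2 ⟨A.top_mem, Filter.univ_mem⟩
  empty_notMem hx := Filter.empty_notMem _ (mem_generatedFilter.1 hx).2
  inter_mem x hx y hy := by
    rw [mem_generatedFilter] at *
    exact ⟨A.infClosed hx.1 hy.1, Filter.inter_mem hx.2 hy.2⟩
  mem_of_superset x hx y hy hxy := by
    rw [mem_generatedFilter] at *
    exact ⟨hy, Filter.mem_of_superset hx.2 hxy⟩
  mem_or_compl_mem x hx := by
    rw [mem_generatedFilter, mem_generatedFilter]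
    exact (h x hx).imp (fun h => ⟨hx, h⟩) fun h => ⟨BooleanSubalgebra.compl_mem hx, h⟩

namespace IsUltrafilterOn

variable {A : BooleanSubalgebra (Set ℕ)} {v : Set (Set ℕ)}

theorem sInter_mem (hv : IsUltrafilterOn A v) {H : Set (Set ℕ)} (hH : H.Finite) (hHv : H ⊆ v) :
    ⋂₀ H ∈ v := by
  induction H, hH using Set.Finite.induction_on with
  | empty => simpa using hv.univ_mem
  | insert _ _ ih =>
    rw [sInter_insert]
    exact hv.inter_mem _ (hHv (mem_insert _ _)) _ (ih ((subset_insert _ _).trans hHv))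

theorem generate_neBot (hv : IsUltrafilterOn A v) : (Filter.generate v).NeBot := by
  refine Filter.generate_neBot_iff.2 fun H hHv hH => ?_
  rw [nonempty_iff_ne_empty]
  intro h
  exact hv.empty_notMem (h ▸ hv.sInter_mem hH hHv)

theorem compl_notMem (hv : IsUltrafilterOn A v) {x : Set ℕ} (hx : x ∈ v) : xᶜ ∉ v := fun h =>
  hv.empty_notMem (by simpa using hv.inter_mem x hx _ h)

/-- An ultrafilter containing a generating family of another one is equal to it. -/
theorem eq_generatedFilter (hv : IsUltrafilterOn A v) {G : Set (Set ℕ)}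
    (hu : IsUltrafilterOn A (generatedFilter A G)) (hG : G ⊆ v) : v = generatedFilter A G := by
  have h : generatedFilter A G ⊆ v := by
    rintro x ⟨hx, H, hHG, hH, hHx⟩
    exact hv.mem_of_superset _ (hv.sInter_mem hH (hHG.trans hG)) _ hx hHx
  refine Subset.antisymm (fun x hx => ?_) h
  exact (hu.mem_or_compl_mem x (hv.mem_algebra x hx)).resolve_right fun hc =>
    hv.compl_notMem hx (h hc)

end IsUltrafilterOn

theorem subset_generatedAlgebra (F : Set (Set ℕ)) :
    F ∪ {x | xᶜ.Finite} ⊆ (generatedAlgebra F : Set (Set ℕ)) := by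
  rintro x (hx | hx)
  · exact BooleanSubalgebra.subset_closure (Or.inl hx)
  · exact BooleanSubalgebra.compl_mem_iff.1 (BooleanSubalgebra.subset_closure (Or.inr hx))

/-- All members of the filter generated by `G` contain `P` up to finitely many points, while both
`Q` and `P \ Q` are infinite. So this filter decides neither `Q` nor `Qᶜ`, and it is the only
ultrafilter with this defect. -/
theorem isMinimalFor_of_isPseudointersection {F : Set (Set ℕ)} {P Q x : Set ℕ}
    (hP : IsPseudointersection P F) (hQP : Q ⊆ P) (hQ : Q.Infinite) (hPQ : (P \ Q).Infinite)
    (hx : x = Q ∨ x = Qᶜ) :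
    IsMinimalFor x (generatedAlgebra F)
      (generatedFilter (generatedAlgebra F) (F ∪ {x | xᶜ.Finite})) := by
  set G := F ∪ {x | xᶜ.Finite} with hGdef
  set A := generatedAlgebra F with hA
  have hGP : ∀ g ∈ G, (P \ g).Finite := by
    rintro g (hg | hg)
    · exact hP.2 g hg
    · exact Set.Finite.subset hg fun x hx => hx.2
  have hmemP : ∀ (K : Set (Set ℕ)), (∀ g ∈ K, (P \ g).Finite) → ∀ y ∈ Filter.generate K,
      (P \ y).Finite := by
    intro K hK y hy
    induction hy with
    | basic h => exact hK _ h
    | univ => simp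
    | superset _ h ih => exact ih.subset (sdiff_subset_sdiff_right h)
    | inter _ _ h1 h2 => rw [sdiff_inter]; exact h1.union h2
  have hu : IsUltrafilterOn A (generatedFilter A G) := by
    refine isUltrafilterOn_generatedFilter ?_ fun y hy => mem_or_compl_mem_of_mem_closure ?_ hy
    · rw [Filter.neBot_iff, ne_eq, ← Filter.empty_mem_iff_bot]
      intro h
      exact hP.1 (by simpa using hmemP G hGP _ h)
    · rintro y (hy | hy)
      · exact Or.inl (Filter.mem_generate_of_mem (Or.inl hy))
      · exact Or.inr (Filter.mem_generate_of_mem (Or.inr (by simpa using hy)))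
  have hxB : x ∈ adjoin A x := BooleanSubalgebra.subset_closure (Or.inr rfl)
  intro v
  constructor
  · rintro ⟨hv, hnv⟩
    by_contra hne
    have hg : ∃ g ∈ G, gᶜ ∈ v := by
      by_contra! hc
      exact hne (hv.eq_generatedFilter hu fun g hg =>
        (hv.mem_or_compl_mem g (subset_generatedAlgebra F hg)).resolve_right (hc g hg))
    obtain ⟨g, hg, hgv⟩ := hg
    have hfin : (gᶜ ∩ Q).Finite := (hGP g hg).subset fun y hy => ⟨hQP hy.2, hy.1⟩
    -- The finite set `gᶜ ∩ Q` belongs to the algebra, so `v` decides it; together with `gᶜ ∈ v`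
    -- this decides `Q`.
    have hQv : Q ∈ Filter.generate v ∨ Qᶜ ∈ Filter.generate v := by
      rcases hv.mem_or_compl_mem _ (BooleanSubalgebra.subset_closure (Or.inr hfin)) with h | h
      · exact Or.inl (Filter.mem_of_superset (Filter.mem_generate_of_mem h) inter_subset_right)
      · refine Or.inr (Filter.mem_of_superset (Filter.inter_mem
          (Filter.mem_generate_of_mem h) (Filter.mem_generate_of_mem hgv)) ?_)
        exact fun y hy hyQ => hy.1 ⟨hy.2, hyQ⟩
    refine hnv (isUltrafilterOn_generatedFilter hv.generate_neBot fun y hy =>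
      mem_or_compl_mem_of_mem_closure ?_ hy)
    rintro y (hy | hy)
    · exact (hv.mem_or_compl_mem y hy).imp Filter.mem_generate_of_mem Filter.mem_generate_of_mem
    · rw [mem_singleton_iff] at hy
      subst hy
      rcases hx with rfl | rfl
      · exact hQv
      · rwa [compl_compl, or_comm]
  · rintro rfl
    refine ⟨hu, fun hB => ?_⟩
    have hmem : ∀ y, y ∈ generatedFilter (adjoin A x) (generatedFilter A G) → (P \ y).Finite :=
      fun y hy => hmemP _ (fun z hz => hmemP G hGP z (mem_generatedFilter.1 hz).2) y
        (mem_generatedFilter.1 hy).2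
    have h1 : ¬ (P \ Q).Finite := hPQ
    have h2 : ¬ (P \ Qᶜ).Finite := by
      rw [sdiff_compl, inter_eq_self_of_subset_right hQP]
      exact hQ
    rcases hB.mem_or_compl_mem x hxB with h | h <;> rcases hx with rfl | rfl
    · exact h1 (hmem _ h)
    · exact h2 (hmem _ h)
    · exact h2 (hmem _ h)
    · exact h1 (by simpa using hmem _ h)

theorem IsPseudointersectionLabeling.generatesTAlgebra {a : BinSeq → Set ℕ}
    (ha : IsPseudointersectionLabeling a) :
    GeneratesTAlgebra pseudointersectionNumber
      (BinSeq.succTree pseudointersectionNumber) a := by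
  have hsub : ∀ (r : BinSeq) (i : Bool),
      a '' {s | s ∈ BinSeq.succTree pseudointersectionNumber ∧ s < r.snoc i} ⊆
        a '' {s | s ≤ r} := fun r i =>
    image_mono fun s hs => BinSeq.lt_snoc_iff.1 hs.2
  refine ⟨BinSeq.isAcceptable_succTree _, ?_, ?_, ?_, ?_⟩
  · intro t ht
    obtain ⟨r, hr, i, rfl⟩ := BinSeq.exists_eq_snoc_of_mem_succTree ht
    obtain ⟨P, Q, hP, hQP, hQ, hPQ, h0, h1⟩ := ha.succ r hr
    cases i
    · rwa [h0]
    · rw [h1]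
      exact hPQ.mono fun x hx => hx.2
  · intro t ht
    obtain ⟨P, Q, hP, hQP, hQ, hPQ, h0, h1⟩ :=
      ha.succ t (BinSeq.mem_fullTree_of_le (BinSeq.lt_snoc_self t false).le ht.1)
    rw [h0, h1]
  · intro t ht
    obtain ⟨r, hr, i, rfl⟩ := BinSeq.exists_eq_snoc_of_mem_succTree ht
    obtain ⟨P, Q, hP, -⟩ := ha.succ r hr
    exact (hP.mono (hsub r i)).isCentered
  · intro t ht
    obtain ⟨r, hr, i, rfl⟩ := BinSeq.exists_eq_snoc_of_mem_succTree ht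
    obtain ⟨P, Q, hP, hQP, hQ, hPQ, h0, h1⟩ := ha.succ r hr
    refine isMinimalFor_of_isPseudointersection (hP.mono (hsub r i)) hQP hQ hPQ ?_
    cases i
    · exact Or.inl h0
    · exact Or.inr h1

/-! ### Infinite sets not split by the labels -/

namespace BinSeq

/-- If the labels at the left successors of nodes are almost contained in the labels below them,
and the labels at limit nodes are almost contained in the labels below them, then every infinite set
has an infinite subset that is not split by any label at a node of successor length. -/
theorem exists_infinite_forall_not_split {κ : Cardinal.{0}} {c : BinSeq → Set ℕ}
    (hcompl : ∀ t ∈ fullTree κ, c (t.snoc true) = (c (t.snoc false))ᶜ)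
    (hsucc : ∀ t ∈ fullTree κ, ∀ r ≤ t, (c (t.snoc false) \ c r).Finite)
    (hlim : ∀ s ∈ fullTree κ, Order.IsSuccLimit s.length → ∀ r < s, (c s \ c r).Finite)
    {X : Set ℕ} (hX : X.Infinite) :
    ∃ Y ⊆ X, Y.Infinite ∧
      ∀ t ∈ fullTree κ, (Y \ c (t.snoc false)).Finite ∨ (Y ∩ c (t.snoc false)).Finite := by
  classical
  by_contra! hc
  have hcompl' : ∀ t ∈ fullTree κ, ∀ i, c (t.snoc (!i)) = (c (t.snoc i))ᶜ := by
    intro t ht i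
    cases i <;> simp [hcompl t ht]
  have hdec : ∀ t ∈ fullTree κ, ∀ (i : Bool) (Z : Set ℕ), (Z \ c (t.snoc i)).Finite →
      (Z \ c (t.snoc false)).Finite ∨ (Z ∩ c (t.snoc false)).Finite := by
    intro t ht i Z hZ
    cases i
    · exact Or.inl hZ
    · rw [hcompl t ht, sdiff_compl] at hZ
      exact Or.inr hZ
  -- A minimal splitting node `t`: by minimality, `Y` is almost contained in every successor label
  -- on the path to `t`.
  have step : ∀ Y : {Y : Set ℕ // Y ⊆ X ∧ Y.Infinite}, ∃ t ∈ fullTree κ,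
      (Y.1 \ c (t.snoc false)).Infinite ∧ (Y.1 ∩ c (t.snoc false)).Infinite ∧
      ∀ (r : BinSeq) (i : Bool), r.snoc i ≤ t → (Y.1 \ c (r.snoc i)).Finite := by
    rintro ⟨Y, hYX, hY⟩
    obtain ⟨t, ⟨ht, h1, h2⟩, hmin⟩ := (wellFounded_lt (α := BinSeq)).has_min
      {t | t ∈ fullTree κ ∧ (Y \ c (t.snoc false)).Infinite ∧ (Y ∩ c (t.snoc false)).Infinite}
      (hc Y hYX hY)
    refine ⟨t, ht, h1, h2, fun r i hri => ?_⟩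
    have hrt : r < t := (lt_snoc_self r i).trans_le hri
    have hr := mem_fullTree_of_le hrt.le ht
    -- The left label at `t` is almost contained in `c (r.snoc i)` and meets `Y` in an infinite set,
    -- so `Y` cannot be almost disjoint from `c (r.snoc i)`.
    have hinf : ¬ (Y ∩ c (r.snoc i)).Finite := fun hf => by
      refine h2 ((hf.union (hsucc t ht _ hri)).subset fun y hy => ?_)
      by_cases hyr : y ∈ c (r.snoc i)
      · exact Or.inl ⟨hy.1, hyr⟩
      · exact Or.inr ⟨hy.2, hyr⟩
    by_contra hfin
    refine hmin r ⟨hr, ?_⟩ hrt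
    cases i
    · exact ⟨hfin, hinf⟩
    · rw [hcompl r hr, sdiff_compl] at hfin
      rw [hcompl r hr, ← sdiff_eq] at hinf
      exact ⟨hinf, hfin⟩
  choose τ hτ hsplit hsplit' hbelow using step
  let next : {Y : Set ℕ // Y ⊆ X ∧ Y.Infinite} → {Y : Set ℕ // Y ⊆ X ∧ Y.Infinite} := fun Y =>
    ⟨Y.1 ∩ c ((τ Y).snoc false), inter_subset_left.trans Y.2.1, hsplit' Y⟩
  -- `next Y` is almost contained in all successor labels up to `(τ Y).snoc false`. A node properly
  -- below it thus does not split `next Y`, and one incomparable to it would put `next Y` almost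
  -- inside two complementary labels.
  have hnext : ∀ Y, (τ Y).snoc false ≤ τ (next Y) := by
    intro Y
    have h1 : ∀ (r : BinSeq) (i : Bool), r.snoc i ≤ (τ Y).snoc false → ((next Y).1 \ c (r.snoc i)).Finite := by
      intro r i hri
      rcases hri.eq_or_lt with h | h
      · rw [h, sdiff_eq_empty.2 inter_subset_right]
        exact finite_empty
      · exact (hbelow Y r i (lt_snoc_iff.1 h)).subset
          (sdiff_subset_sdiff_left inter_subset_left)
    by_contra hn
    by_cases hle : τ (next Y) ≤ (τ Y).snoc false
    · obtain ⟨i, hi⟩ := exists_snoc_le_of_lt (lt_of_le_not_ge hle hn)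
      rcases hdec _ (hτ _) i _ (h1 _ _ hi) with h | h
      · exact hsplit (next Y) h
      · exact hsplit' (next Y) h
    · obtain ⟨m, i, h2, h3⟩ := exists_snoc_le_snoc_le hn hle
      have hm : m ∈ fullTree κ :=
        mem_fullTree_of_le ((lt_snoc_self m _).le.trans h3) (hτ (next Y))
      have h4 := hbelow _ _ _ h3
      rw [hcompl' m hm, sdiff_compl] at h4
      refine (next Y).2.2 (((h1 _ _ h2).union h4).subset fun y hy => ?_)
      by_cases hym : y ∈ c (m.snoc i)
      · exact Or.inr ⟨hy, hym⟩
      · exact Or.inl ⟨hy, hym⟩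
  let S : ℕ → {Y : Set ℕ // Y ⊆ X ∧ Y.Infinite} := fun n => next^[n] ⟨X, Subset.rfl, hX⟩
  have hS : ∀ n, S (n + 1) = next (S n) := fun n => Function.iterate_succ_apply' _ _ _
  have hSanti : Antitone fun n => (S n).1 := antitone_nat_of_succ_le fun n => by
    rw [hS]
    exact inter_subset_left
  have hlt : ∀ n, (τ (S n)).snoc false ≤ τ (S (n + 1)) := fun n => hS n ▸ hnext (S n)
  obtain ⟨s, hslim, hts, hst⟩ := exists_sup (fun n => τ (S n))
    (strictMono_nat_of_lt_succ fun n => (lt_snoc_self _ _).trans_le (hlt n))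
  -- As `s` lies above `(τ (S n)).snoc false`, the set `c s` is almost contained in that left label,
  -- and infinitely many points of `S n` outside the label remain to avoid `c s`. The length of `s`
  -- may reach the height of the tree; then no node of the tree extends `s` and nothing is required.
  have hz : ∀ n, ∃ z ∈ (S n).1, z ∉ c ((τ (S n)).snoc false) ∧ (s ∈ fullTree κ → z ∉ c s) := by
    intro n
    by_cases hs : s ∈ fullTree κ
    · obtain ⟨z, hz, hzs⟩ := ((hsplit (S n)).sdiff
        (hlim s hs hslim _ ((hlt n).trans_lt (hts (n + 1))))).nonempty
      exact ⟨z, hz.1, hz.2, fun _ hzc => hzs ⟨hzc, hz.2⟩⟩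
    · obtain ⟨z, hz⟩ := (hsplit (S n)).nonempty
      exact ⟨z, hz.1, hz.2, fun h => absurd h hs⟩
  choose z hzS hzt hzs using hz
  have hzne : ∀ m n, m < n → z m ≠ z n := by
    intro m n hmn h
    have h1 : z n ∈ (S (m + 1)).1 := hSanti hmn (hzS n)
    rw [hS, ← h] at h1
    exact hzt m h1.2
  have hinj : Function.Injective z := fun m n h => by
    by_contra hne
    rcases lt_or_gt_of_ne hne with hl | hl
    · exact hzne _ _ hl h
    · exact hzne _ _ hl h.symm
  have hZfin : ∀ n, (range z \ (S n).1).Finite := by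
    intro n
    refine ((finite_Iio n).image z).subset ?_
    rintro _ ⟨⟨m, rfl⟩, hm⟩
    refine ⟨m, ?_, rfl⟩
    by_contra hnm
    exact hm (hSanti (not_lt.1 hnm) (hzS m))
  have hZ : ∀ (r : BinSeq) (i : Bool), r.snoc i ≤ s → (range z \ c (r.snoc i)).Finite := by
    intro r i hri
    -- A node of limit length is not a `snoc`, so `r.snoc i` lies below some `τ (S n)`.
    have hne : r.snoc i ≠ s := fun h => by
      rw [← h] at hslim
      exact (Order.isSuccPrelimit_iff_succ_lt.1 hslim.2 _ (lt_add_one r.length)).ne rfl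
    obtain ⟨n, hn⟩ := hst _ (lt_of_le_of_ne hri hne)
    refine ((hZfin n).union (hbelow (S n) r i hn)).subset fun y hy => ?_
    by_cases hyS : y ∈ (S n).1
    · exact Or.inr ⟨hyS, hy.2⟩
    · exact Or.inl ⟨hy.1, hyS⟩
  have hZX : range z ⊆ X := by
    rintro _ ⟨n, rfl⟩
    exact (S n).2.1 (hzS n)
  obtain ⟨t, ht, h1, h2⟩ := hc _ hZX (infinite_range_of_injective hinj)
  -- If `s ≤ t`, the left label at `t` is almost inside `c s`, which `range z` avoids. If `t < s`,
  -- the path to `s` decides. Otherwise `range z` and the left label at `t` are almost inside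
  -- complementary labels.
  by_cases hst' : s ≤ t
  · refine h2 ((hsucc t ht s hst').subset ?_)
    rintro _ ⟨⟨n, rfl⟩, hn⟩
    exact ⟨hn, hzs n (mem_fullTree_of_le hst' ht)⟩
  by_cases hts' : t ≤ s
  · obtain ⟨i, hi⟩ := exists_snoc_le_of_lt (lt_of_le_not_ge hts' hst')
    rcases hdec t ht i _ (hZ _ _ hi) with h | h
    · exact h1 h
    · exact h2 h
  · obtain ⟨m, i, h3, h4⟩ := exists_snoc_le_snoc_le hst' hts'
    have hm : m ∈ fullTree κ := mem_fullTree_of_le ((lt_snoc_self m _).le.trans h4) ht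
    have h5 := hsucc t ht _ h4
    rw [hcompl' m hm, sdiff_compl] at h5
    refine h2 (((hZ _ _ h3).union h5).subset fun y hy => ?_)
    by_cases hym : y ∈ c (m.snoc i)
    · exact Or.inr ⟨hy.2, hym⟩
    · exact Or.inl ⟨hy.1, hym⟩

end BinSeq

/-! ### Sequential compactness of the Stone space -/

theorem Ultrafilter.exists_singleton_mem_of_finite {U : Ultrafilter ℕ} {s : Set ℕ}
    (hs : s.Finite) (h : s ∈ U) : ∃ k ∈ s, {k} ∈ U := by
  rw [← biUnion_of_singleton s] at h
  exact (Ultrafilter.finite_biUnion_mem_iff hs).1 h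

/-- Ultrafilters on all of `ℕ` also decide the labels at limit nodes, which need not belong to the
algebra. -/
theorem IsUltrafilterOn.exists_ultrafilter {A : BooleanSubalgebra (Set ℕ)} {v : Set (Set ℕ)}
    (hv : IsUltrafilterOn A v) : ∃ U : Ultrafilter ℕ, ∀ b ∈ A, b ∈ U ↔ b ∈ v := by
  have := hv.generate_neBot
  refine ⟨Ultrafilter.of (Filter.generate v), fun b hb => ⟨fun h => ?_, fun h => ?_⟩⟩
  · refine (hv.mem_or_compl_mem b hb).resolve_right fun hc => ?_
    exact Ultrafilter.compl_notMem_iff.2 h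
      (Ultrafilter.of_le _ (Filter.mem_generate_of_mem hc))
  · exact Ultrafilter.of_le _ (Filter.mem_generate_of_mem h)

/-- Every sequence of ultrafilters has a subsequence along which each member of the algebra is
eventually decided. -/
theorem IsPseudointersectionLabeling.exists_subseq {a : BinSeq → Set ℕ}
    (ha : IsPseudointersectionLabeling a) (U : ℕ → Ultrafilter ℕ) :
    ∃ φ : ℕ → ℕ, StrictMono φ ∧
      ∀ b ∈ generatedAlgebra (a '' BinSeq.succTree pseudointersectionNumber),
        (∀ᶠ n in Filter.atTop, b ∈ U (φ n)) ∨ ∀ᶠ n in Filter.atTop, bᶜ ∈ U (φ n) := by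
  by_cases hk : ∃ k : ℕ, {n | {k} ∈ U n}.Infinite
  · obtain ⟨k, hk⟩ := hk
    refine ⟨Nat.nth fun n => {k} ∈ U n, Nat.nth_strictMono hk, fun b _ => ?_⟩
    have hmem : ∀ n, {k} ∈ U (Nat.nth (fun n => {k} ∈ U n) n) := Nat.nth_mem_of_infinite hk
    by_cases hkb : k ∈ b
    · exact Or.inl (Filter.Eventually.of_forall fun n =>
        Filter.mem_of_superset (hmem n) (singleton_subset_iff.2 hkb))
    · exact Or.inr (Filter.Eventually.of_forall fun n =>
        Filter.mem_of_superset (hmem n) (singleton_subset_iff.2 hkb))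
  push Not at hk
  have hfin : ∀ s : Set ℕ, s.Finite → {n | s ∈ U n}.Finite := fun s hs =>
    (hs.biUnion fun k _ => hk k).subset fun n hn => by
      obtain ⟨k, hks, hkn⟩ := Ultrafilter.exists_singleton_mem_of_finite hs hn
      exact mem_biUnion hks hkn
  -- An index in the difference has `x \ y` in its ultrafilter, and a finite set lies in only
  -- finitely many `U n`.
  have hdiff : ∀ x y : Set ℕ, (x \ y).Finite → ({n | x ∈ U n} \ {n | y ∈ U n}).Finite :=
    fun x y hxy => (hfin _ hxy).subset fun n hn =>
      Filter.inter_mem hn.1 (Ultrafilter.compl_mem_iff_notMem.2 hn.2)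
  obtain ⟨Y, -, hY, hdec⟩ := BinSeq.exists_infinite_forall_not_split
    (κ := pseudointersectionNumber) (c := fun t => {n | a t ∈ U n})
    (fun t ht => by
      obtain ⟨P, Q, -, -, -, -, h0, h1⟩ := ha.succ t ht
      ext n
      rw [mem_ofPred_eq, h1, mem_compl_iff, mem_ofPred_eq, h0, Ultrafilter.compl_mem_iff_notMem])
    (fun t ht r hr => by
      obtain ⟨P, Q, hP, hQP, -, -, h0, h1⟩ := ha.succ t ht
      refine hdiff _ _ ?_
      rw [h0]
      exact (hP.2 _ ⟨r, hr, rfl⟩).subset (sdiff_subset_sdiff_left hQP))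
    (fun s hs hl r hr => hdiff _ _ ((ha.limit s hs hl).2 _ ⟨r, hr, rfl⟩)) infinite_univ
  have hmono := Nat.nth_strictMono (p := (· ∈ Y)) hY
  have hYmem : ∀ n, Nat.nth (· ∈ Y) n ∈ Y := Nat.nth_mem_of_infinite hY
  have hev : ∀ s : Set ℕ, s.Finite → ∀ᶠ n in Filter.atTop, Nat.nth (· ∈ Y) n ∉ s := fun s hs =>
    (hmono.tendsto_atTop.eventually (Nat.cofinite_eq_atTop ▸ hs.eventually_cofinite_notMem))
  refine ⟨Nat.nth (· ∈ Y), hmono, fun b hb => ?_⟩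
  -- The filter `l` consists of the sets that eventually belong to the ultrafilters of the
  -- subsequence, so only generators need to be decided.
  refine mem_or_compl_mem_of_mem_closure
    (l := Filter.bind Filter.atTop fun n => (U (Nat.nth (· ∈ Y) n) : Filter ℕ)) ?_ hb
  have hleft : ∀ t ∈ BinSeq.fullTree pseudointersectionNumber,
      (∀ᶠ n in Filter.atTop, a (t.snoc false) ∈ U (Nat.nth (· ∈ Y) n)) ∨
        ∀ᶠ n in Filter.atTop, (a (t.snoc false))ᶜ ∈ U (Nat.nth (· ∈ Y) n) := by
    intro t ht
    refine (hdec t ht).imp (fun h => ?_) fun h => ?_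
    · filter_upwards [hev _ h] with n hn
      by_contra hc
      exact hn ⟨hYmem n, hc⟩
    · filter_upwards [hev _ h] with n hn
      exact Ultrafilter.compl_mem_iff_notMem.2 fun hc => hn ⟨hYmem n, hc⟩
  rintro x (⟨t, ht, rfl⟩ | hx)
  · obtain ⟨r, hr, i, rfl⟩ := BinSeq.exists_eq_snoc_of_mem_succTree ht
    cases i
    · exact hleft r hr
    · obtain ⟨P, Q, -, -, -, -, h0, h1⟩ := ha.succ r hr
      rw [h1, compl_compl, or_comm, ← h0]
      exact hleft r hr
  · refine Or.inr ?_
    change ∀ᶠ n in Filter.atTop, xᶜ ∈ U (Nat.nth (· ∈ Y) n)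
    filter_upwards [hev _ (hfin x hx)] with n hn
    exact Ultrafilter.compl_mem_iff_notMem.2 hn

theorem IsPseudointersectionLabeling.seqCompactSpace {a : BinSeq → Set ℕ}
    (ha : IsPseudointersectionLabeling a) :
    SeqCompactSpace
      (StoneSpace (generatedAlgebra (a '' BinSeq.succTree pseudointersectionNumber))) := by
  set A := generatedAlgebra (a '' BinSeq.succTree pseudointersectionNumber)
  refine ⟨fun x _ => ?_⟩
  choose U hU using fun n => (x n).2.exists_ultrafilter
  obtain ⟨φ, hφ, hdec⟩ := ha.exists_subseq U
  -- The limit point is the trace on `A` of the filter of sets eventually in `U (φ n)`.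
  let l : Filter ℕ := Filter.bind Filter.atTop fun n => (U (φ n) : Filter ℕ)
  have hu : IsUltrafilterOn A {b | b ∈ A ∧ b ∈ l} :=
    { mem_algebra := fun b hb => hb.1
      univ_mem := ⟨A.top_mem, Filter.univ_mem⟩
      empty_notMem := fun h => by
        have h1 : ∀ᶠ n in Filter.atTop, ∅ ∈ U (φ n) := h.2
        obtain ⟨n, hn⟩ := h1.exists
        exact (U (φ n)).empty_notMem hn
      inter_mem := fun b hb d hd => ⟨A.infClosed hb.1 hd.1, Filter.inter_mem hb.2 hd.2⟩
      mem_of_superset := fun b hb d hd hbd => ⟨hd, Filter.mem_of_superset hb.2 hbd⟩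
      mem_or_compl_mem := fun b hb => (hdec b hb).imp (fun h => ⟨hb, h⟩)
        fun h => ⟨BooleanSubalgebra.compl_mem hb, h⟩ }
  refine ⟨(⟨_, hu⟩ : StoneSpace A), mem_univ _, φ, hφ, ?_⟩
  refine TopologicalSpace.tendsto_nhds_generateFrom_iff.2 ?_
  rintro _ ⟨b, hb, rfl⟩ hbu
  have h1 : ∀ᶠ n in Filter.atTop, b ∈ U (φ n) := hbu.2
  filter_upwards [h1] with n hn
  exact (hU (φ n) b hb).1 hn

theorem mainTheorem3 :
    (∃ a : BinSeq → Set ℕ, IsPseudointersectionLabeling a) ∧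
    ∀ a : BinSeq → Set ℕ, IsPseudointersectionLabeling a →
      GeneratesTAlgebra pseudointersectionNumber
          (BinSeq.succTree pseudointersectionNumber) a ∧
        SeqCompactSpace
          (StoneSpace (generatedAlgebra (a '' BinSeq.succTree pseudointersectionNumber))) := by
  exact ⟨⟨_, isPseudointersectionLabeling_labeling⟩,
    fun _ ha => ⟨ha.generatesTAlgebra, ha.seqCompactSpace⟩⟩
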